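/- Let $p$ be an odd prime and let $T$ be the $p$-regular rooted tree, whose vertices are the finite words over the alphabet $\{1,\dots,p\}$. Let $a\in\operatorname{Aut}(T)$ be the rooted automorphism that permutes the first-level subtrees according to the cycle $(1\,2\,\dots\,p)$ of the first letters, without changing the later letters. For an automorphism $g$ fixing the first level of $T$, write $\psi(g)=(g_1,\dots,g_p)$ for the automorphisms that $g$ induces on the subtrees rooted at the first-level vertices $1,\dots,p$, each identified with $T$. Let $r\ge 2$, let $\mathbf e_1,\dots,\mathbf e_r\in\mathbb F_p^{\,p-1}$ be linearly independent vectors, $\mathbf e_i=(e_{i,1},\dots,e_{i,p-1})$, and let $b_i\in\operatorname{Aut}(T)$ be the automorphism that fixes the first level and is defined recursively by $$\psi(b_i)=(a^{e_{i,1}},\dots,a^{e_{i,p-1}},b_i).$$ Let $G=\langle a,b_1,\dots,b_r\rangle$ (a multi-GGS-group with $r\geq 2$ directed generators), and for $n\ge 0$ let $\mathrm{St}_G(n)$ be the subgroup of the elements of $G$ that fix every vertex of level $n$. Then $G$ has the congruence subgroup property: every subgroup of finite index in $G$ contains $\mathrm{St}_G(n)$ for some $n$. Moreover, $G''\ge \mathrm{St}_G(r+3)$,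 where $G''$ is the second derived subgroup of $G$. -/

import Mathlib

/-- The group of automorphisms of the rooted regular tree whose vertices are the finite words over
the alphabet `X` (the root is the empty word, the `n`-th level consists of the words of length `n`,
and `u` lies on the path from the root to `v` exactly when `u` is a prefix of `v`): the permutations
of the vertices that preserve the levels and the prefix relation. -/
def treeAut (X : Type*) : Subgroup (Equiv.Perm (List X)) where
  carrier := {g | (∀ v, (g v).length = v.length) ∧ ∀ u v, g u <+: g v ↔ u <+: v}
  one_mem' := by simp
  mul_mem' := by
    rintro g h ⟨hg, hg'⟩ ⟨hh, hh'⟩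
    exact ⟨fun v => by simp [hg, hh], fun u v => by simp [hg', hh']⟩
  inv_mem' := by
    rintro g ⟨hg, hg'⟩
    refine ⟨fun v => ?_, fun u v => ?_⟩
    · rw [← hg (g⁻¹ v)]; simp
    · rw [← hg' (g⁻¹ u)]; simp

/-- The permutation `a` of the words over `ZMod p` that adds one to the first letter. -/
def rootedPerm (p : ℕ) : Equiv.Perm (List (ZMod p)) where
  toFun
    | [] => []
    | x :: w => (x + 1) :: w
  invFun
    | [] => []
    | x :: w => (x - 1) :: w
  left_inv := by rintro (_ | ⟨x, w⟩) <;> simp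
  right_inv := by rintro (_ | ⟨x, w⟩) <;> simp

/-- The rooted automorphism `a`. The children of a vertex are labelled by the residues
`1, …, p - 1, p = 0` modulo `p`, so that `a` acts on the first level as the cycle `(1 2 … p)`. -/
def rootedAut (p : ℕ) : treeAut (ZMod p) :=
  ⟨rootedPerm p, by
    refine ⟨?_, ?_⟩
    · rintro (_ | ⟨x, w⟩) <;> simp [rootedPerm]
    · rintro (_ | ⟨x, w⟩) (_ | ⟨y, z⟩) <;> simp [rootedPerm, List.cons_prefix_cons]⟩

/-- A word beginning with the letter `0 = p` is changed recursively below this letter, and a word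
beginning with another letter `x` is changed below `x` by the automorphism `s x`. -/
def directedFun {p : ℕ} (s : {x : ZMod p // x ≠ 0} → treeAut (ZMod p)) :
    List (ZMod p) → List (ZMod p)
  | [] => []
  | x :: w => if h : x = 0 then x :: directedFun s w else x :: (s ⟨x, h⟩ : Equiv.Perm _) w

theorem directedFun_inv {p : ℕ} (s : {x : ZMod p // x ≠ 0} → treeAut (ZMod p))
    (v : List (ZMod p)) : directedFun s⁻¹ (directedFun s v) = v := by
  induction v with
  | nil => rfl
  | cons x w ih => by_cases h : x = 0 <;> simp [directedFun, h, ih]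

/-- The directed automorphism `b` with defining vector `e = (e_1, …, e_{p-1})`, whose coordinates
are indexed by the nonzero residues: it fixes the first level, and
`ψ(b) = (a ^ e_1, …, a ^ e_{p-1}, b)`. -/
def directedAut {p : ℕ} (e : {x : ZMod p // x ≠ 0} → ZMod p) : treeAut (ZMod p) :=
  ⟨{ toFun := directedFun fun x => rootedAut p ^ (e x).val
     invFun := directedFun (fun x => rootedAut p ^ (e x).val)⁻¹
     left_inv := directedFun_inv _
     right_inv := fun v => by
      simpa using directedFun_inv (fun x => rootedAut p ^ (e x).val)⁻¹ v }, by
    refine ⟨fun v => ?_, fun u => ?_⟩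
    · change (directedFun _ v).length = _
      induction v with
      | nil => rfl
      | cons x w ih =>
        by_cases h : x = 0
        · simp [directedFun, h, ih]
        · simpa [directedFun, h] using (rootedAut p ^ (e ⟨x, h⟩).val).2.1 w
    · change ∀ v, directedFun _ u <+: directedFun _ v ↔ _
      induction u with
      | nil => simp [directedFun]
      | cons x w ih =>
        rintro (_ | ⟨y, z⟩)
        · by_cases h : x = 0 <;> simp [directedFun, h]
        · by_cases hxy : x = y
          · subst hxy
            by_cases h : x = 0
            · simp [directedFun, h, ih, List.cons_prefix_cons]
            · simpa [directedFun, h, List.cons_prefix_cons] using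
                (rootedAut p ^ (e ⟨x, h⟩).val).2.2 w z
          · by_cases h : x = 0 <;> by_cases h' : y = 0 <;>
              simp [directedFun, h, h', hxy, List.cons_prefix_cons] <;> grind⟩

theorem rootedAut_nil (p : ℕ) : (rootedAut p : Equiv.Perm (List (ZMod p))) [] = [] := rfl

theorem rootedAut_cons {p : ℕ} (x : ZMod p) (w : List (ZMod p)) :
    (rootedAut p : Equiv.Perm (List (ZMod p))) (x :: w) = (x + 1) :: w := rfl

theorem directedAut_nil {p : ℕ} (e : {x : ZMod p // x ≠ 0} → ZMod p) :
    (directedAut e : Equiv.Perm (List (ZMod p))) [] = [] := rfl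

theorem directedAut_zero_cons {p : ℕ} (e : {x : ZMod p // x ≠ 0} → ZMod p) (w : List (ZMod p)) :
    (directedAut e : Equiv.Perm (List (ZMod p))) (0 :: w) =
      0 :: (directedAut e : Equiv.Perm (List (ZMod p))) w := by
  simp [directedAut, directedFun]

theorem directedAut_cons {p : ℕ} (e : {x : ZMod p // x ≠ 0} → ZMod p) (x : {x : ZMod p // x ≠ 0})
    (w : List (ZMod p)) :
    (directedAut e : Equiv.Perm (List (ZMod p))) (x.1 :: w) =
      x.1 :: ((rootedAut p ^ (e x).val : treeAut (ZMod p)) : Equiv.Perm (List (ZMod p))) w := by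
  simp [directedAut, directedFun, x.2]

/-- The group generated by the rooted automorphism `a` and the directed automorphisms
`b_1, …, b_r` with defining vectors `e 0, …, e (r - 1)`. It is a multi-GGS-group when `p` is an odd
prime and the defining vectors are linearly independent. -/
def multiGGSGroup {p r : ℕ} (e : Fin r → {x : ZMod p // x ≠ 0} → ZMod p) :
    Subgroup (treeAut (ZMod p)) :=
  Subgroup.closure (insert (rootedAut p) (Set.range fun i => directedAut (e i)))

/-- The stabilizer `St_G(n)` of the `n`-th level of the tree: the elements of `G` that fix every
vertex of level `n`. -/
def levelStabilizer {X : Type*} (G : Subgroup (treeAut X)) (n : ℕ) : Subgroup G where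
  carrier := {g | ∀ v : List X, v.length = n → (g : Equiv.Perm (List X)) v = v}
  one_mem' := by simp
  mul_mem' := by
    intro g h hg hh v hv
    simp [hh v hv, hg v hv]
  inv_mem' := by
    intro g hg v hv
    exact Equiv.Perm.inv_eq_iff_eq.mpr (hg v hv).symm

/-- The congruence subgroup property: every subgroup of finite index contains a level
stabilizer. -/
def HasCongruenceSubgroupProperty {X : Type*} (G : Subgroup (treeAut X)) : Prop :=
  ∀ H : Subgroup G, H.FiniteIndex → ∃ n : ℕ, levelStabilizer G n ≤ H

/-! Let E be the span of the defining vectors, of dimension r, and γ₃ = [G', G].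

St_G(r+1) ≤ G'. A word has a total vector in E, and its coordinates have vectors V_j that add up to
this total. If the word fixes level n+2, the a-exponents of the coordinates vanish, which is a
convolution identity on the V_j. Comparing lowest nonzero moments, the space of totals of words
fixing a level drops strictly from each level n ≥ 1 to the next until it is zero
(`stabilizerVectors_succ_lt`). A word with zero totals lies in G'.

Since r ≥ 2, G' projects onto G in each coordinate (`directedGroup_le_derivedCoord`), and a copy of
G' in one coordinate lies in St_G(1)' ≤ γ₃ (`place_mem_commutator_firstStabilizer`). A copy of γ₃ in
one coordinate lies in G''. Descending two levels from St_G(r+3) and returning through G', γ₃ and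
G'' gives the explicit bound.

For the congruence property, a nontrivial subgroup normalized by G contains G'' below every vertex
of some level n (`placeAt_commutator_mem` and transitivity), hence St_G(r+3+n). G is infinite, so
normal cores of finite index are nontrivial. -/

namespace treeAut

/-! ### Automorphisms acting below a given vertex -/

variable {X : Type*}

theorem ext_cons {g h : treeAut X}
    (H : ∀ x w, (g : Equiv.Perm (List X)) (x :: w) = (h : Equiv.Perm (List X)) (x :: w)) :
    g = h := by
  refine Subtype.ext (Equiv.ext fun v => ?_)
  cases v with
  | nil => rw [List.eq_nil_of_length_eq_zero (g.2.1 []), List.eq_nil_of_length_eq_zero (h.2.1 [])]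
  | cons x w => exact H x w

/-- The permutation of the words that fixes the first letter `x` and acts by `s x` below it. -/
def fiberPerm (s : X → treeAut X) : Equiv.Perm (List X) where
  toFun
    | [] => []
    | x :: w => x :: (s x : Equiv.Perm (List X)) w
  invFun
    | [] => []
    | x :: w => x :: ((s x)⁻¹ : Equiv.Perm (List X)) w
  left_inv := by rintro (_ | ⟨x, w⟩) <;> simp
  right_inv := by rintro (_ | ⟨x, w⟩) <;> simp

/-- The tree automorphism that fixes the first level and acts by `s x` below the vertex `x`; this
is the inverse of the map `ψ`. -/
def fiber : (X → treeAut X) →* treeAut X where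
  toFun s := ⟨fiberPerm s, by
    refine ⟨?_, ?_⟩
    · rintro (_ | ⟨x, w⟩)
      · rfl
      · simpa [fiberPerm] using (s x).2.1 w
    · rintro (_ | ⟨x, w⟩) (_ | ⟨y, z⟩)
      · simp [fiberPerm]
      · simp [fiberPerm]
      · simp [fiberPerm]
      · simp only [fiberPerm, Equiv.coe_fn_mk, List.cons_prefix_cons]
        refine and_congr_right ?_
        rintro rfl
        exact (s x).2.2 w z⟩
  map_one' := ext_cons fun x w => rfl
  map_mul' s t := ext_cons fun x w => rfl

theorem fiber_cons (s : X → treeAut X) (x : X) (w : List X) :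
    (fiber s : Equiv.Perm (List X)) (x :: w) = x :: (s x : Equiv.Perm (List X)) w := rfl

/-- The automorphism `k` placed below the first-level vertex `x`. -/
def place [DecidableEq X] (x : X) : treeAut X →* treeAut X :=
  fiber.comp (MonoidHom.mulSingle (fun _ => treeAut X) x)

theorem place_apply [DecidableEq X] (x : X) (k : treeAut X) :
    place x k = fiber (Pi.mulSingle x k) := rfl

theorem place_self_cons [DecidableEq X] (x : X) (k : treeAut X) (w : List X) :
    (place x k : Equiv.Perm (List X)) (x :: w) = x :: (k : Equiv.Perm (List X)) w := by
  rw [place_apply, fiber_cons, Pi.mulSingle_eq_same]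

theorem place_cons_of_ne [DecidableEq X] {x y : X} (h : y ≠ x) (k : treeAut X) (w : List X) :
    (place x k : Equiv.Perm (List X)) (y :: w) = y :: w := by
  rw [place_apply, fiber_cons, Pi.mulSingle_eq_of_ne h]
  rfl

theorem fiber_mem_of_place_mem [DecidableEq X] [Finite X] {H : Subgroup (treeAut X)}
    {s : X → treeAut X} (h : ∀ x, place x (s x) ∈ H) : fiber s ∈ H :=
  Subgroup.pi_mem_of_mulSingle_mem (H := H.comap fiber) s h

theorem fiber_mul_place_mul_inv [DecidableEq X] (s : X → treeAut X) (x : X) (k : treeAut X) :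
    fiber s * place x k * (fiber s)⁻¹ = place x (s x * k * (s x)⁻¹) := by
  rw [place_apply, place_apply, ← map_inv, ← map_mul, ← map_mul]
  congr 1
  ext1 y
  by_cases h : y = x
  · subst h; simp
  · simp [Pi.mulSingle_eq_of_ne h]

open scoped commutatorElement in
theorem commutator_place_fiber [DecidableEq X] (s : X → treeAut X) (x : X) (k : treeAut X) :
    ⁅place x k, fiber s⁆ = place x ⁅k, s x⁆ := by
  rw [commutatorElement_def, mul_assoc, mul_assoc, ← mul_assoc (fiber s), ← map_inv (place x),
    fiber_mul_place_mul_inv, ← map_mul, commutatorElement_def]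
  simp only [mul_assoc]

/-- The automorphism `k` placed below the vertex `u`. -/
def placeAt [DecidableEq X] : List X → treeAut X →* treeAut X
  | [] => MonoidHom.id _
  | x :: u => (place x).comp (placeAt u)

theorem placeAt_apply_of_not_prefix [DecidableEq X] (u : List X) (k : treeAut X) (v : List X)
    (h : ¬ u <+: v) : (placeAt u k : Equiv.Perm (List X)) v = v := by
  induction u generalizing v with
  | nil => simp at h
  | cons x u ih =>
    cases v with
    | nil => rfl
    | cons y w =>
      change (place x (placeAt u k) : Equiv.Perm (List X)) (y :: w) = y :: w
      by_cases hxy : y = x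
      · subst hxy
        rw [place_self_cons, ih w fun hw => h (List.cons_prefix_cons.2 ⟨rfl, hw⟩)]
      · rw [place_cons_of_ne hxy]

/-- The stabilizer of the `n`-th level in the full automorphism group. -/
def fixLevel (n : ℕ) : Subgroup (treeAut X) where
  carrier := {g | ∀ v : List X, v.length = n → (g : Equiv.Perm (List X)) v = v}
  one_mem' := by simp
  mul_mem' := by
    intro g h hg hh v hv
    simp [hh v hv, hg v hv]
  inv_mem' := by
    intro g hg v hv
    exact Equiv.Perm.inv_eq_iff_eq.mpr (hg v hv).symm

theorem fiber_mem_fixLevel_succ {n : ℕ} {s : X → treeAut X} :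
    fiber s ∈ fixLevel (n + 1) ↔ ∀ x, s x ∈ fixLevel n := by
  constructor
  · intro h x w hw
    simpa [fiber_cons] using h (x :: w) (by simp [hw])
  · rintro h (_ | ⟨x, w⟩) hw
    · simp at hw
    · rw [fiber_cons, h x w (by simpa using hw)]

/-- The usual double commutator trick: with A, B placed at `u`, the element [A, g] = A·c lies in N,
where c = gA⁻¹g⁻¹ acts only below g(u) ≠ u. So c commutes with B and [A·c, B] = [A, B]. -/
theorem placeAt_commutator_mem [DecidableEq X] {N G K : Subgroup (treeAut X)}
    (hN : ∀ g ∈ N, ∀ h ∈ G, h * g * h⁻¹ ∈ N) {g : treeAut X} (hg : g ∈ N) {u : List X}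
    (hu : (g : Equiv.Perm (List X)) u ≠ u) (hK : ∀ k ∈ K, placeAt u k ∈ G) :
    ∀ k ∈ ⁅K, K⁆, placeAt u k ∈ N := by
  suffices ⁅K, K⁆ ≤ N.comap (placeAt u) from this
  rw [Subgroup.commutator_le]
  intro k hk l hl
  have hcomm : Commute (g * placeAt u k⁻¹ * g⁻¹) (placeAt u l) := by
    apply Subtype.ext
    refine (Equiv.Perm.Disjoint.commute fun v => ?_ :
      Commute ((g * placeAt u k⁻¹ * g⁻¹ : treeAut X) : Equiv.Perm (List X)) (placeAt u l)).eq
    by_cases hv : u <+: v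
    · left
      -- Otherwise `u` and its image under `g` would be prefixes of `v` of equal length, hence
      -- equal.
      have hv' : ¬ u <+: ((g⁻¹ : treeAut X) : Equiv.Perm (List X)) v := fun h' => by
        have h2 := (g.2.2 _ _).2 h'
        have h3 : (g : Equiv.Perm (List X)) (((g⁻¹ : treeAut X) : Equiv.Perm (List X)) v) = v := by
          simp
        rw [h3] at h2
        exact hu (List.IsPrefix.eq_of_length
          (List.prefix_of_prefix_length_le h2 hv (g.2.1 u).le) (g.2.1 u))
      have := placeAt_apply_of_not_prefix u k⁻¹ _ hv'
      simp only [Subgroup.coe_mul, Equiv.Perm.mul_apply, this]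
      simp
    · right
      exact placeAt_apply_of_not_prefix u l v hv
  rw [Subgroup.mem_comap, map_commutatorElement]
  have hc : placeAt u k * (g * placeAt u k⁻¹ * g⁻¹) ∈ N := by
    have := N.mul_mem (hN g hg _ (hK k hk)) (N.inv_mem hg)
    simpa [mul_assoc] using this
  have := N.mul_mem hc (N.inv_mem (hN _ hc _ (hK l hl)))
  convert this using 1
  have h2 : (g * placeAt u k⁻¹ * g⁻¹) * (placeAt u l * (g * placeAt u k⁻¹ * g⁻¹)⁻¹) =
      placeAt u l := by
    rw [← mul_assoc, hcomm.eq, mul_assoc, mul_inv_cancel, mul_one]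
  rw [commutatorElement_def, mul_inv_rev, mul_inv_rev, mul_inv_rev]
  generalize g * placeAt u k⁻¹ * g⁻¹ = c at *
  generalize placeAt u k = A at *
  generalize placeAt u l = B at *
  rw [inv_inv]
  calc A * B * A⁻¹ * B⁻¹ = A * (c * (B * c⁻¹)) * A⁻¹ * B⁻¹ := by rw [h2]
    _ = _ := by
      have : c * B * c⁻¹ = B := by rw [mul_assoc, h2]
      have h3 : c * B⁻¹ * c⁻¹ = B⁻¹ := by
        rw [← conj_inv, this]
      group

end treeAut

/-! ### Rotations, directed automorphisms and their coordinates -/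

namespace MultiGGS

open treeAut
open scoped commutatorElement

variable {p : ℕ}

theorem rootedAut_pow_cons (n : ℕ) (x : ZMod p) (w : List (ZMod p)) :
    ((rootedAut p ^ n : treeAut (ZMod p)) : Equiv.Perm (List (ZMod p))) (x :: w) =
      (x + n) :: w := by
  induction n generalizing x with
  | zero => simp
  | succ n ih =>
    rw [pow_succ, Subgroup.coe_mul, Equiv.Perm.mul_apply, rootedAut_cons, ih]
    push_cast
    rw [add_assoc, add_comm (1 : ZMod p)]

/-- The rooted automorphism that adds `c` to the first letter. -/
def rot (c : ZMod p) : treeAut (ZMod p) := rootedAut p ^ c.val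

variable [Fact p.Prime]

theorem rot_cons (c x : ZMod p) (w : List (ZMod p)) :
    (rot c : Equiv.Perm (List (ZMod p))) (x :: w) = (x + c) :: w := by
  rw [rot, rootedAut_pow_cons, ZMod.natCast_zmod_val]

theorem rot_add (c d : ZMod p) : rot (c + d) = rot c * rot d :=
  ext_cons fun x w => by
    rw [Subgroup.coe_mul, Equiv.Perm.mul_apply, rot_cons, rot_cons, rot_cons, add_assoc,
      add_comm c d]

theorem rot_zero : rot (0 : ZMod p) = 1 := by simp [rot]

theorem rot_one : rot (1 : ZMod p) = rootedAut p :=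
  ext_cons fun x w => by rw [rot_cons, rootedAut_cons]

theorem rot_neg (c : ZMod p) : rot (-c) = (rot c)⁻¹ := by
  rw [eq_inv_iff_mul_eq_one, ← rot_add, neg_add_cancel, rot_zero]

theorem rot_comm (c d : ZMod p) : rot c * rot d = rot d * rot c := by
  rw [← rot_add, ← rot_add, add_comm]

theorem rot_mul_fiber (c : ZMod p) (s : ZMod p → treeAut (ZMod p)) :
    rot c * fiber s = fiber (fun x => s (x - c)) * rot c :=
  ext_cons fun x w => by
    simp [rot_cons, fiber_cons]

theorem rot_conj_fiber (c : ZMod p) (s : ZMod p → treeAut (ZMod p)) :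
    rot c * fiber s * (rot c)⁻¹ = fiber (fun x => s (x - c)) := by
  rw [rot_mul_fiber, mul_inv_cancel_right]

theorem rot_conj_place (c x : ZMod p) (k : treeAut (ZMod p)) :
    rot c * place x k * (rot c)⁻¹ = place (x + c) k := by
  rw [place_apply, rot_conj_fiber, place_apply]
  congr 1
  ext1 y
  simp [Pi.mulSingle_apply, sub_eq_iff_eq_add]

/-- The extension by zero of a function on the nonzero residues. -/
def extendZero : ({x : ZMod p // x ≠ 0} → ZMod p) →ₗ[ZMod p] (ZMod p → ZMod p) where
  toFun v x := if h : x = 0 then 0 else v ⟨x, h⟩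
  map_add' v w := by ext x; by_cases h : x = 0 <;> simp [h]
  map_smul' c v := by ext x; by_cases h : x = 0 <;> simp [h]

theorem extendZero_zero (v : {x : ZMod p // x ≠ 0} → ZMod p) : extendZero v 0 = 0 := by
  simp [extendZero]

theorem extendZero_coe (v : {x : ZMod p // x ≠ 0} → ZMod p) (x : {x : ZMod p // x ≠ 0}) :
    extendZero v x = v x := by
  simp [extendZero, x.2]

theorem directedAut_cons_of_ne (v : {x : ZMod p // x ≠ 0} → ZMod p) {x : ZMod p} (hx : x ≠ 0)
    (w : List (ZMod p)) :
    (directedAut v : Equiv.Perm (List (ZMod p))) (x :: w) =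
      x :: (rot (extendZero v x) : Equiv.Perm (List (ZMod p))) w := by
  rw [directedAut_cons v ⟨x, hx⟩, ← extendZero_coe v ⟨x, hx⟩]
  rfl

/-- The coordinates `ψ(b) = (a ^ e_1, …, a ^ e_{p-1}, b)` of a directed automorphism. -/
def directedCoord (v : {x : ZMod p // x ≠ 0} → ZMod p) (x : ZMod p) : treeAut (ZMod p) :=
  if x = 0 then directedAut v else rot (extendZero v x)

theorem directedCoord_zero (v : {x : ZMod p // x ≠ 0} → ZMod p) :
    directedCoord v 0 = directedAut v := by simp [directedCoord]

theorem directedCoord_of_ne (v : {x : ZMod p // x ≠ 0} → ZMod p) {x : ZMod p} (hx : x ≠ 0) :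
    directedCoord v x = rot (extendZero v x) := by simp [directedCoord, hx]

theorem directedAut_eq_fiber (v : {x : ZMod p // x ≠ 0} → ZMod p) :
    directedAut v = fiber (directedCoord v) :=
  ext_cons fun x w => by
    rw [fiber_cons]
    by_cases h : x = 0
    · subst h
      rw [directedAut_zero_cons, directedCoord_zero]
    · rw [directedAut_cons_of_ne v h, directedCoord_of_ne v h]

theorem directedAut_add (v w : {x : ZMod p // x ≠ 0} → ZMod p) :
    directedAut (v + w) = directedAut v * directedAut w := by
  refine Subtype.ext (Equiv.ext fun u => ?_)
  induction u with
  | nil => rfl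
  | cons x u ih =>
    rw [Subgroup.coe_mul, Equiv.Perm.mul_apply] at ih ⊢
    by_cases h : x = 0
    · subst h
      rw [directedAut_zero_cons, ih, directedAut_zero_cons, directedAut_zero_cons]
    · rw [directedAut_cons_of_ne _ h, directedAut_cons_of_ne _ h, directedAut_cons_of_ne _ h,
        map_add, Pi.add_apply, rot_add, Subgroup.coe_mul, Equiv.Perm.mul_apply]

theorem directedAut_zero : directedAut (0 : {x : ZMod p // x ≠ 0} → ZMod p) = 1 := by
  have := directedAut_add (0 : {x : ZMod p // x ≠ 0} → ZMod p) 0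
  rwa [add_zero, left_eq_mul] at this

theorem directedAut_neg (v : {x : ZMod p // x ≠ 0} → ZMod p) :
    directedAut (-v) = (directedAut v)⁻¹ := by
  rw [eq_inv_iff_mul_eq_one, ← directedAut_add, neg_add_cancel, directedAut_zero]

theorem directedAut_comm (v w : {x : ZMod p // x ≠ 0} → ZMod p) :
    directedAut v * directedAut w = directedAut w * directedAut v := by
  rw [← directedAut_add, ← directedAut_add, add_comm]

/-! ### Exponent sums of words and of their coordinates -/

/-- `WordValue E g c v` says that `g` is the value of a word in the rooted automorphism `a` and the
directed automorphisms with defining vector in `E` such that the exponents of `a` add up to `c` and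
the defining vectors of the directed letters add up to `v`. -/
inductive WordValue (E : Submodule (ZMod p) ({x : ZMod p // x ≠ 0} → ZMod p)) :
    treeAut (ZMod p) → ZMod p → ({x : ZMod p // x ≠ 0} → ZMod p) → Prop
  | rot (c : ZMod p) : WordValue E (rot c) c 0
  | directed (v : {x : ZMod p // x ≠ 0} → ZMod p) (hv : v ∈ E) : WordValue E (directedAut v) 0 v
  | mul {g h : treeAut (ZMod p)} {c d : ZMod p} {v w : {x : ZMod p // x ≠ 0} → ZMod p}
      (hg : WordValue E g c v) (hh : WordValue E h d w) : WordValue E (g * h) (c + d) (v + w)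

namespace WordValue

variable {E : Submodule (ZMod p) ({x : ZMod p // x ≠ 0} → ZMod p)}

theorem one : WordValue E 1 0 0 := rot_zero (p := p) ▸ WordValue.rot 0

theorem inv {g : treeAut (ZMod p)} {c : ZMod p} {v : {x : ZMod p // x ≠ 0} → ZMod p}
    (h : WordValue E g c v) : WordValue E g⁻¹ (-c) (-v) := by
  induction h with
  | rot c => rw [← rot_neg, neg_zero]; exact .rot _
  | directed v hv => rw [← directedAut_neg, neg_zero]; exact .directed _ (E.neg_mem hv)
  | mul _ _ ihg ihh =>
    rw [mul_inv_rev, neg_add_rev, neg_add_rev]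
    exact ihh.mul ihg

theorem pow {g : treeAut (ZMod p)} {c : ZMod p} {v : {x : ZMod p // x ≠ 0} → ZMod p}
    (h : WordValue E g c v) (n : ℕ) : WordValue E (g ^ n) (n • c) (n • v) := by
  induction n with
  | zero => simpa using one
  | succ n ih => rw [pow_succ, succ_nsmul, succ_nsmul]; exact ih.mul h

theorem vector_mem {g : treeAut (ZMod p)} {c : ZMod p} {v : {x : ZMod p // x ≠ 0} → ZMod p}
    (h : WordValue E g c v) : v ∈ E := by
  induction h with
  | rot c => exact E.zero_mem
  | directed v hv => exact hv
  | mul _ _ ihg ihh => exact E.add_mem ihg ihh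

/-- The coordinates of the value of a word are the values of words whose exponents are given by
the numbers of occurrences of the conjugates of the directed letters in the original word. -/
theorem exists_coord {g : treeAut (ZMod p)} {c : ZMod p} {v : {x : ZMod p // x ≠ 0} → ZMod p}
    (h : WordValue E g c v) :
    ∃ (s : ZMod p → treeAut (ZMod p)) (V : ZMod p → {x : ZMod p // x ≠ 0} → ZMod p),
      g = fiber s * MultiGGS.rot c ∧
      (∀ x, WordValue E (s x) (∑ j, extendZero (V j) (x - j)) (V x)) ∧ ∑ j, V j = v := by
  induction h with
  | rot c => exact ⟨1, 0, by simp, fun x => by simpa using one, by simp⟩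
  | directed v hv =>
    refine ⟨directedCoord v, Pi.single 0 v, ?_, fun x => ?_, by simp⟩
    · rw [rot_zero, mul_one, directedAut_eq_fiber]
    · have hs : ∑ j, extendZero ((Pi.single 0 v : ZMod p → {x : ZMod p // x ≠ 0} → ZMod p) j)
          (x - j) = extendZero v x := by
        rw [Finset.sum_eq_single 0 (fun j _ hj => by simp [hj]) (by simp), Pi.single_eq_same,
          sub_zero]
      rw [hs]
      by_cases hx : x = 0
      · subst hx
        rw [extendZero_zero, directedCoord_zero, Pi.single_eq_same]
        exact .directed v hv
      · rw [directedCoord_of_ne v hx, Pi.single_eq_of_ne hx]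
        exact .rot _
  | @mul g h c d v w _ _ ihg ihh =>
    obtain ⟨s, V, rfl, hs, rfl⟩ := ihg
    obtain ⟨t, W, rfl, ht, rfl⟩ := ihh
    -- Moving `rot c` to the right past `fiber t` translates the coordinates of the second factor,
    -- and their vectors, by `c`.
    refine ⟨s * fun x => t (x - c), V + fun x => W (x - c), ?_, fun x => ?_, ?_⟩
    · rw [map_mul, rot_add, mul_assoc, ← mul_assoc (MultiGGS.rot c), rot_mul_fiber]
      simp only [mul_assoc]
    · have hsum : ∑ j, extendZero ((V + fun x => W (x - c)) j) (x - j) =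
          ∑ j, extendZero (V j) (x - j) + ∑ j, extendZero (W j) (x - c - j) := by
        rw [← Equiv.sum_comp (Equiv.subRight c)
          (fun j => (extendZero (W j) : ZMod p → ZMod p) (x - c - j)), ← Finset.sum_add_distrib]
        refine Finset.sum_congr rfl fun j _ => ?_
        rw [Pi.add_apply, map_add, Pi.add_apply, Equiv.subRight_apply, sub_sub_sub_cancel_right]
      rw [hsum]
      exact (hs x).mul (ht (x - c))
    · simp only [Pi.add_apply, Finset.sum_add_distrib]
      congr 1
      exact Equiv.sum_comp (Equiv.subRight c) W

theorem exponent_eq_zero {g : treeAut (ZMod p)} {c : ZMod p}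
    {v : {x : ZMod p // x ≠ 0} → ZMod p} (h : WordValue E g c v) {n : ℕ}
    (hg : g ∈ fixLevel (n + 1)) : c = 0 := by
  obtain ⟨s, V, rfl, -, -⟩ := h.exists_coord
  have := hg (0 :: List.replicate n 0) (by simp)
  rw [Subgroup.coe_mul, Equiv.Perm.mul_apply, rot_cons, fiber_cons, zero_add] at this
  exact (List.cons.inj this).1

end WordValue

/-! ### Moments of defining vectors -/

section moment

/-- The moment `∑ x, x ^ k * v x` of a vector whose coordinates are the nonzero residues. -/
def moment (k : ℕ) (v : {x : ZMod p // x ≠ 0} → ZMod p) : ZMod p :=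
  ∑ x, x ^ k * extendZero v x

theorem sum_add_pow_mul_extendZero (v : {x : ZMod p // x ≠ 0} → ZMod p) (j : ZMod p) (k : ℕ) :
    ∑ x, (x + j) ^ k * extendZero v x =
      ∑ i ∈ Finset.range (k + 1), j ^ (k - i) * (k.choose i : ZMod p) * moment i v := by
  simp only [add_pow, Finset.sum_mul, moment, Finset.mul_sum]
  rw [Finset.sum_comm]
  refine Finset.sum_congr rfl fun i _ => Finset.sum_congr rfl fun x _ => ?_
  ring

theorem moment_sum {ι : Type*} (s : Finset ι) (V : ι → {x : ZMod p // x ≠ 0} → ZMod p) (k : ℕ) :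
    moment k (∑ j ∈ s, V j) = ∑ j ∈ s, moment k (V j) := by
  simp only [moment, map_sum, Finset.sum_apply, Finset.mul_sum]
  rw [Finset.sum_comm]

/-- By Fermat, 1 - (x - t)^(p-1) is the indicator of t, so each coordinate of `v` is a combination
of its moments. -/
theorem exists_moment_ne_zero {v : {x : ZMod p // x ≠ 0} → ZMod p} (hv : v ≠ 0) :
    ∃ k, moment k v ≠ 0 := by
  by_contra! h
  refine hv (funext fun t => ?_)
  have h1 : ∑ x, (x + -t.1) ^ (p - 1) * extendZero v x = 0 := by
    rw [sum_add_pow_mul_extendZero]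
    simp [h]
  have h0 : ∑ x, extendZero v x = 0 := by simpa [moment] using h 0
  have h2 : ∑ x, (1 - (x + -t.1) ^ (p - 1)) * extendZero v x = 0 := by
    simp only [sub_mul, one_mul, Finset.sum_sub_distrib, h0, h1, sub_zero]
  rw [Finset.sum_eq_single t.1 (fun x _ hx => by
      rw [ZMod.pow_card_sub_one_eq_one (by rwa [← sub_eq_add_neg, sub_ne_zero]), sub_self,
        zero_mul]) (by simp)] at h2
  rw [add_neg_cancel, zero_pow (Nat.sub_pos_of_lt (Fact.out : p.Prime).one_lt).ne', sub_zero,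
    one_mul, extendZero_coe] at h2
  exact h2

/-- If the convolution `∑ j, δ_j * V j` vanishes and all moments of the `V j` below the `k`-th do,
then so does the `k`-th moment of `∑ j, V j`. -/
theorem moment_sum_eq_zero {V : ZMod p → {x : ZMod p // x ≠ 0} → ZMod p} {k : ℕ}
    (hV : ∀ j, ∀ i < k, moment i (V j) = 0) (hc : ∀ x, ∑ j, extendZero (V j) (x - j) = 0) :
    moment k (∑ j, V j) = 0 := by
  have h : ∑ x, x ^ k * ∑ j, extendZero (V j) (x - j) = 0 := by simp [hc]
  rw [moment_sum, ← h]
  simp only [Finset.mul_sum]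
  rw [Finset.sum_comm]
  refine Finset.sum_congr rfl fun j _ => ?_
  -- After the shift by `j`, the binomial expansion leaves only the `k`-th moment of `V j`, with
  -- coefficient 1.
  rw [← Equiv.sum_comp (Equiv.addRight j) (fun x => x ^ k * extendZero (V j) (x - j))]
  simp only [Equiv.coe_addRight, add_sub_cancel_right]
  rw [sum_add_pow_mul_extendZero, Finset.sum_range_succ, Finset.sum_eq_zero]
  · simp
  · intro i hi
    rw [hV j i (Finset.mem_range.1 hi), mul_zero]

end moment

/-! ### The strictly decreasing chain of total vectors -/

/-- The vectors `v` that are the total defining vector of some word whose value fixes the `n`-th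
level. -/
def stabilizerVectors (E : Submodule (ZMod p) ({x : ZMod p // x ≠ 0} → ZMod p)) (n : ℕ) :
    Submodule (ZMod p) ({x : ZMod p // x ≠ 0} → ZMod p) where
  carrier := {v | ∃ g ∈ fixLevel n, ∃ c, WordValue E g c v}
  zero_mem' := ⟨1, one_mem _, 0, .one⟩
  add_mem' := by
    rintro v w ⟨g, hg, c, h⟩ ⟨g', hg', c', h'⟩
    exact ⟨g * g', mul_mem hg hg', c + c', h.mul h'⟩
  smul_mem' := by
    rintro k v ⟨g, hg, c, h⟩
    refine ⟨g ^ k.val, pow_mem hg _, k.val • c, ?_⟩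
    convert h.pow k.val using 1
    rw [← Nat.cast_smul_eq_nsmul (ZMod p), ZMod.natCast_zmod_val]

variable {E : Submodule (ZMod p) ({x : ZMod p // x ≠ 0} → ZMod p)}

/-- The coordinates fix level n+1 ≥ 1, so they fix first letters and their a-exponents, which form
the convolution, vanish. -/
theorem exists_coord_of_mem_stabilizerVectors {n : ℕ} {v : {x : ZMod p // x ≠ 0} → ZMod p}
    (hv : v ∈ stabilizerVectors E (n + 2)) :
    ∃ V : ZMod p → {x : ZMod p // x ≠ 0} → ZMod p, (∀ x, V x ∈ stabilizerVectors E (n + 1)) ∧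
      (∀ x, ∑ j, extendZero (V j) (x - j) = 0) ∧ ∑ j, V j = v := by
  obtain ⟨g, hg, c, h⟩ := hv
  obtain rfl : c = 0 := h.exponent_eq_zero hg
  obtain ⟨s, V, rfl, hs, hV⟩ := h.exists_coord
  rw [rot_zero, mul_one, fiber_mem_fixLevel_succ] at hg
  exact ⟨V, fun x => ⟨s x, hg x, _, hs x⟩, fun x => (hs x).exponent_eq_zero (hg x), hV⟩

theorem stabilizerVectors_succ_le (n : ℕ) :
    stabilizerVectors E (n + 2) ≤ stabilizerVectors E (n + 1) := fun v hv => by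
  obtain ⟨V, hV, -, rfl⟩ := exists_coord_of_mem_stabilizerVectors hv
  exact Submodule.sum_mem _ fun j _ => hV j

/-- Take the least k for which some vector of the larger space has a nonzero k-th moment. If the
spaces agreed, this vector would be a sum of vectors of the space with vanishing convolution; their
lower moments vanish by minimality, and so its k-th moment would vanish too. -/
theorem stabilizerVectors_succ_lt {n : ℕ} (h : stabilizerVectors E (n + 1) ≠ ⊥) :
    stabilizerVectors E (n + 2) < stabilizerVectors E (n + 1) := by
  classical
  refine lt_of_le_of_ne (stabilizerVectors_succ_le n) fun heq => ?_
  have hex : ∃ k, ∃ v ∈ stabilizerVectors E (n + 1), moment k v ≠ 0 := by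
    obtain ⟨v, hv, hv0⟩ := Submodule.exists_mem_ne_zero_of_ne_bot h
    obtain ⟨k, hk⟩ := exists_moment_ne_zero hv0
    exact ⟨k, v, hv, hk⟩
  obtain ⟨v, hv, hvk⟩ := Nat.find_spec hex
  rw [← heq] at hv
  obtain ⟨V, hV, hc, rfl⟩ := exists_coord_of_mem_stabilizerVectors hv
  refine hvk (moment_sum_eq_zero (fun j i hi => ?_) hc)
  by_contra hne
  exact Nat.find_min hex hi ⟨V j, hV j, hne⟩

theorem finrank_stabilizerVectors_le (n : ℕ) :
    Module.finrank (ZMod p) (stabilizerVectors E (n + 1)) ≤ Module.finrank (ZMod p) E - n := by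
  induction n with
  | zero =>
    refine Submodule.finrank_mono ?_
    rintro v ⟨g, -, c, h⟩
    exact h.vector_mem
  | succ n ih =>
    by_cases h : stabilizerVectors E (n + 1) = ⊥
    · have := stabilizerVectors_succ_le (E := E) n
      rw [h, le_bot_iff] at this
      rw [this, finrank_bot]
      exact Nat.zero_le _
    · have := Submodule.finrank_lt_finrank_of_lt (stabilizerVectors_succ_lt h)
      change Module.finrank (ZMod p) (stabilizerVectors E (n + 2)) ≤ _
      omega

theorem stabilizerVectors_eq_bot : stabilizerVectors E (Module.finrank (ZMod p) E + 1) = ⊥ := by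
  have := finrank_stabilizerVectors_le (E := E) (Module.finrank (ZMod p) E)
  rw [Nat.sub_self, Nat.le_zero] at this
  exact Submodule.finrank_eq_zero.1 this

/-! ### Commutators and the derived subgroup -/

theorem conj_mem_commutator {T : Type*} [Group T] {G H K : Subgroup T}
    (hH : ∀ h ∈ H, ∀ g ∈ G, g * h * g⁻¹ ∈ H) (hK : ∀ k ∈ K, ∀ g ∈ G, g * k * g⁻¹ ∈ K) :
    ∀ k ∈ ⁅H, K⁆, ∀ g ∈ G, g * k * g⁻¹ ∈ ⁅H, K⁆ := by
  intro k hk g hg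
  suffices ⁅H, K⁆ ≤ ⁅H, K⁆.comap (MulAut.conj g).toMonoidHom from this hk
  rw [Subgroup.commutator_le]
  intro x hx y hy
  rw [Subgroup.mem_comap, map_commutatorElement]
  exact Subgroup.commutator_mem_commutator (hH x hx g hg) (hK y hy g hg)

theorem conj_mem_self {T : Type*} [Group T] {G : Subgroup T} :
    ∀ k ∈ G, ∀ g ∈ G, g * k * g⁻¹ ∈ G :=
  fun _ hk _ hg => mul_mem (mul_mem hg hk) (inv_mem hg)

theorem commutator_self_le {T : Type*} [Group T] (G : Subgroup T) : ⁅G, G⁆ ≤ G := by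
  rw [Subgroup.commutator_le]
  intro x hx y hy
  rw [commutatorElement_def]
  exact mul_mem (mul_mem (mul_mem hx hy) (inv_mem hx)) (inv_mem hy)

theorem commutator_mul_left {T : Type*} [Group T] (x y z : T) :
    ⁅x * y, z⁆ = x * ⁅y, z⁆ * x⁻¹ * ⁅x, z⁆ := by
  simp only [commutatorElement_def]; group

theorem commutator_mul_right {T : Type*} [Group T] (x y z : T) :
    ⁅x, y * z⁆ = ⁅x, y⁆ * (y * ⁅x, z⁆ * y⁻¹) := by
  simp only [commutatorElement_def]; group

variable (E) in
/-- The group generated by the rooted automorphism and the directed automorphisms with defining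
vector in `E`. -/
def directedGroup : Subgroup (treeAut (ZMod p)) where
  carrier := {g | ∃ c v, WordValue E g c v}
  one_mem' := ⟨0, 0, .one⟩
  mul_mem' := by
    rintro g h ⟨c, v, hg⟩ ⟨d, w, hh⟩
    exact ⟨c + d, v + w, hg.mul hh⟩
  inv_mem' := by
    rintro g ⟨c, v, hg⟩
    exact ⟨-c, -v, hg.inv⟩

theorem rot_mem (c : ZMod p) : rot c ∈ directedGroup E := ⟨c, 0, .rot c⟩

theorem directedAut_mem {v : {x : ZMod p // x ≠ 0} → ZMod p} (hv : v ∈ E) :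
    directedAut v ∈ directedGroup E := ⟨0, v, .directed v hv⟩

theorem multiGGSGroup_eq {r : ℕ} (e : Fin r → {x : ZMod p // x ≠ 0} → ZMod p) :
    multiGGSGroup e = directedGroup (Submodule.span (ZMod p) (Set.range e)) := by
  refine le_antisymm ?_ ?_
  · rw [multiGGSGroup, Subgroup.closure_le, Set.insert_subset_iff]
    refine ⟨rot_one (p := p) ▸ rot_mem 1, ?_⟩
    rintro _ ⟨i, rfl⟩
    exact directedAut_mem (Submodule.subset_span ⟨i, rfl⟩)
  · rintro g ⟨c, v, h⟩
    induction h with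
    | rot c => exact pow_mem (Subgroup.subset_closure (Set.mem_insert _ _)) _
    | directed v hv =>
      induction hv using Submodule.span_induction with
      | mem v hv =>
        obtain ⟨i, rfl⟩ := hv
        exact Subgroup.subset_closure (Set.mem_insert_of_mem _ ⟨i, rfl⟩)
      | zero => exact directedAut_zero (p := p) ▸ one_mem _
      | add v w _ _ hv hw => exact directedAut_add v w ▸ mul_mem hv hw
      | smul k v _ hv =>
        have hpow : ∀ n : ℕ, directedAut (n • v) ∈ multiGGSGroup e := by
          intro n
          induction n with
          | zero => rw [zero_nsmul, directedAut_zero]; exact one_mem _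
          | succ n ih => rw [succ_nsmul, directedAut_add]; exact mul_mem ih hv
        rw [← ZMod.natCast_zmod_val k, Nat.cast_smul_eq_nsmul]
        exact hpow _
    | mul _ _ hg hh => exact mul_mem hg hh

theorem directedGroup_le {K : Subgroup (treeAut (ZMod p))} (ha : ∀ c, rot c ∈ K)
    (hb : ∀ v ∈ E, directedAut v ∈ K) : directedGroup E ≤ K := by
  rintro g ⟨c, v, h⟩
  induction h with
  | rot c => exact ha c
  | directed v hv => exact hb v hv
  | mul _ _ hg hh => exact mul_mem hg hh

/-- The derived subgroup is generated, as a normal subgroup, by the commutators `[b, a]`. -/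
theorem commutator_directedGroup_le {K : Subgroup (treeAut (ZMod p))}
    (hK : ∀ k ∈ K, ∀ g ∈ directedGroup E, g * k * g⁻¹ ∈ K)
    (h : ∀ v ∈ E, ⁅directedAut v, rot (1 : ZMod p)⁆ ∈ K) :
    ⁅directedGroup E, directedGroup E⁆ ≤ K := by
  have hrot : ∀ v ∈ E, ∀ c : ZMod p, ⁅directedAut v, rot c⁆ ∈ K := by
    intro v hv c
    have hpow : ∀ n : ℕ, ⁅directedAut v, rot (n : ZMod p)⁆ ∈ K := by
      intro n
      induction n with
      | zero => rw [Nat.cast_zero, rot_zero, commutatorElement_one_right]; exact one_mem K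
      | succ n ih =>
        rw [Nat.cast_succ, rot_add, commutator_mul_right]
        exact mul_mem ih (hK _ (h v hv) _ (rot_mem _))
    rw [← ZMod.natCast_zmod_val c]
    exact hpow _
  have hright : ∀ x ∈ directedGroup E, (∀ c : ZMod p, ⁅x, rot c⁆ ∈ K) →
      (∀ v ∈ E, ⁅x, directedAut v⁆ ∈ K) → ∀ g ∈ directedGroup E, ⁅x, g⁆ ∈ K := by
    rintro x hx ha hb g ⟨c, v, hg⟩
    induction hg with
    | rot c => exact ha c
    | directed v hv => exact hb v hv
    | mul hg _ ihg ihh =>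
      rw [commutator_mul_right]
      exact mul_mem ihg (hK _ ihh _ ⟨_, _, hg⟩)
  rw [Subgroup.commutator_le]
  rintro g ⟨c, v, hg⟩ x hx
  induction hg with
  | rot c =>
    refine hright _ (rot_mem c) (fun d => ?_) (fun v hv => ?_) x hx
    · rw [commutatorElement_eq_one_iff_mul_comm.2 (rot_comm c d)]; exact one_mem K
    · rw [← commutatorElement_inv]; exact inv_mem (hrot v hv c)
  | directed v hv =>
    refine hright _ (directedAut_mem hv) (hrot v hv) (fun w hw => ?_) x hx
    rw [commutatorElement_eq_one_iff_mul_comm.2 (directedAut_comm v w)]; exact one_mem K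
  | mul hg _ ihg ihh =>
    rw [commutator_mul_left]
    exact mul_mem (hK _ ihh _ ⟨_, _, hg⟩) ihg

theorem conj_mem_derived : ∀ k ∈ ⁅directedGroup E, directedGroup E⁆, ∀ g ∈ directedGroup E,
    g * k * g⁻¹ ∈ ⁅directedGroup E, directedGroup E⁆ :=
  conj_mem_commutator conj_mem_self conj_mem_self

/-- Modulo G' the letters of a word can be reordered, so only its totals matter. -/
theorem WordValue.inv_mul_mem_commutator {g : treeAut (ZMod p)} {c : ZMod p}
    {v : {x : ZMod p // x ≠ 0} → ZMod p} (h : WordValue E g c v) :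
    (MultiGGS.rot c * directedAut v)⁻¹ * g ∈ ⁅directedGroup E, directedGroup E⁆ := by
  induction h with
  | rot c => rw [directedAut_zero, mul_one, inv_mul_cancel]; exact one_mem _
  | directed v hv => rw [rot_zero, one_mul, inv_mul_cancel]; exact one_mem _
  | @mul g h c d v w hg hh ihg ihh =>
    have h1 := Subgroup.commutator_mem_commutator
      (inv_mem (directedAut_mem hg.vector_mem)) (inv_mem (rot_mem (E := E) d))
    have h2 := conj_mem_derived _ ihg _ (inv_mem (rot_mem d))
    have h3 := conj_mem_derived _ (mul_mem h1 h2) _ (inv_mem (directedAut_mem hh.vector_mem))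
    convert mul_mem h3 ihh using 1
    rw [rot_add, directedAut_add, commutatorElement_def]
    group

theorem exists_fiber_of_mem_fixLevel {g : treeAut (ZMod p)} (hg : g ∈ directedGroup E) {n : ℕ}
    (hn : g ∈ fixLevel (n + 1)) :
    ∃ s, g = fiber s ∧ ∀ x, s x ∈ directedGroup E ∧ s x ∈ fixLevel n := by
  obtain ⟨c, v, h⟩ := hg
  obtain rfl : c = 0 := h.exponent_eq_zero hn
  obtain ⟨s, V, rfl, hV, -⟩ := h.exists_coord
  rw [rot_zero, mul_one, fiber_mem_fixLevel_succ] at hn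
  exact ⟨s, by rw [rot_zero, mul_one], fun x => ⟨⟨_, _, hV x⟩, hn x⟩⟩

theorem mem_commutator_of_mem_fixLevel {g : treeAut (ZMod p)} (hg : g ∈ directedGroup E)
    (hn : g ∈ fixLevel (Module.finrank (ZMod p) E + 1)) :
    g ∈ ⁅directedGroup E, directedGroup E⁆ := by
  obtain ⟨c, v, h⟩ := hg
  obtain rfl : c = 0 := h.exponent_eq_zero hn
  have hv : v ∈ stabilizerVectors E (Module.finrank (ZMod p) E + 1) := ⟨g, hn, 0, h⟩
  rw [stabilizerVectors_eq_bot, Submodule.mem_bot] at hv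
  subst hv
  simpa [rot_zero, directedAut_zero] using h.inv_mul_mem_commutator

/-! ### Linear algebra in dimension at least two -/

section vectors

variable (hE : 2 ≤ Module.finrank (ZMod p) E)
include hE

theorem exists_ne_zero_extendZero_eq_zero (y : ZMod p) : ∃ u ∈ E, u ≠ 0 ∧ extendZero u y = 0 := by
  have h : LinearMap.ker (((LinearMap.proj y).comp extendZero).domRestrict E :
      E →ₗ[ZMod p] ZMod p) ≠ ⊥ :=
    LinearMap.ker_ne_bot_of_finrank_lt (by rw [Module.finrank_self]; omega)
  obtain ⟨u, hu, hu0⟩ := Submodule.exists_mem_ne_zero_of_ne_bot h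
  exact ⟨u, u.2, fun h => hu0 (Subtype.ext h), hu⟩

omit hE in
theorem exists_extendZero_ne_zero {u : {x : ZMod p // x ≠ 0} → ZMod p} (hu : u ≠ 0) :
    ∃ y, y ≠ 0 ∧ extendZero u y ≠ 0 := by
  obtain ⟨y, hy⟩ := Function.ne_iff.1 hu
  exact ⟨y, y.2, by rwa [extendZero_coe]⟩

theorem exists_nonconstant :
    ∃ v ∈ E, ∃ y z, y ≠ 0 ∧ z ≠ 0 ∧ extendZero v y - extendZero v z = 1 := by
  obtain ⟨u, hu, hu0, h1⟩ := exists_ne_zero_extendZero_eq_zero hE 1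
  obtain ⟨y, hy, huy⟩ := exists_extendZero_ne_zero hu0
  refine ⟨(extendZero u y)⁻¹ • u, E.smul_mem _ hu, y, 1, hy, one_ne_zero, ?_⟩
  rw [map_smul, Pi.smul_apply, Pi.smul_apply, h1, smul_zero, sub_zero, smul_eq_mul,
    inv_mul_cancel₀ huy]

/-- A subspace that contains the vectors of `E` vanishing at `-y`, for every `y` at which not all
vectors of `E` vanish, contains `E`. -/
theorem le_of_vanishing_mem {F : Submodule (ZMod p) ({x : ZMod p // x ≠ 0} → ZMod p)}
    (hF : ∀ y, y ≠ 0 → ∀ w ∈ E, extendZero w y = 1 → ∀ v ∈ E, extendZero v (-y) = 0 → v ∈ F) :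
    E ≤ F := by
  have hF' : ∀ y, y ≠ 0 → ∀ w ∈ E, extendZero w y ≠ 0 →
      ∀ v ∈ E, extendZero v (-y) = 0 → v ∈ F := fun y hy w hw hwy =>
    hF y hy ((extendZero w y)⁻¹ • w) (E.smul_mem _ hw) (by
      rw [map_smul, Pi.smul_apply, smul_eq_mul, inv_mul_cancel₀ hwy])
  -- The position 0 is arbitrary: only a nonzero vector of `E` is needed. It supplies `y`, then `u`
  -- vanishing at `-y` lies in `F`.
  obtain ⟨w, hw, hw0, -⟩ := exists_ne_zero_extendZero_eq_zero hE 0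
  obtain ⟨y, hy, hwy⟩ := exists_extendZero_ne_zero hw0
  obtain ⟨u, hu, hu0, huy⟩ := exists_ne_zero_extendZero_eq_zero hE (-y)
  obtain ⟨z, hz, huz⟩ := exists_extendZero_ne_zero hu0
  intro v hv
  -- If `E` does not vanish identically at `-z`, subtracting a multiple of `u ∈ F` makes `v` vanish
  -- at `z = -(-z)`; otherwise `v` already vanishes at `-z`, and `u` is the witness at `z`.
  by_cases h : ∃ w ∈ E, extendZero w (-z) ≠ 0
  · obtain ⟨w', hw', hwz⟩ := h
    have h1 : v - (extendZero v z / extendZero u z) • u ∈ F := by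
      refine hF' (-z) (neg_ne_zero.2 hz) w' hw' hwz _ (E.sub_mem hv (E.smul_mem _ hu)) ?_
      rw [neg_neg, map_sub, map_smul, Pi.sub_apply, Pi.smul_apply, smul_eq_mul,
        div_mul_cancel₀ _ huz, sub_self]
    have := F.add_mem h1 (F.smul_mem (extendZero v z / extendZero u z) (hF' y hy w hw hwy u hu huy))
    rwa [sub_add_cancel] at this
  · push Not at h
    exact hF' z hz u hu huz v hv (h v hv)

end vectors

/-! ### Copies of the derived subgroup in one coordinate -/

/-- At `y` the recursive coordinate of the conjugate meets `rot 1`; at 0 the recursive coordinate of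
`directedAut w` meets the trivial `rot (extendZero v (-y))`; elsewhere two rotations commute. -/
theorem commutator_directedAut_conj {v w : {x : ZMod p // x ≠ 0} → ZMod p} {y : ZMod p}
    (hy : y ≠ 0) (hw : extendZero w y = 1) (hv : extendZero v (-y) = 0) :
    ⁅rot y * directedAut v * (rot y)⁻¹, directedAut w⁆ =
      place y ⁅directedAut v, rot (1 : ZMod p)⁆ := by
  have h : ⁅rot y * directedAut v * (rot y)⁻¹, directedAut w⁆ =
      fiber ⁅fun x => directedCoord v (x - y), directedCoord w⁆ := by
    rw [map_commutatorElement, ← directedAut_eq_fiber, ← rot_conj_fiber, ← directedAut_eq_fiber]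
  rw [h, place_apply]
  congr 1
  ext1 t
  change ⁅directedCoord v (t - y), directedCoord w t⁆ = _
  by_cases hty : t = y
  · subst hty
    rw [sub_self, directedCoord_zero, directedCoord_of_ne w hy, hw, Pi.mulSingle_eq_same]
  · rw [Pi.mulSingle_eq_of_ne hty, directedCoord_of_ne v (sub_ne_zero.2 hty)]
    by_cases ht : t = 0
    · subst ht
      rw [zero_sub, hv, rot_zero, commutatorElement_one_left]
    · rw [directedCoord_of_ne w ht, commutatorElement_eq_one_iff_mul_comm, rot_comm]

variable (E) in
/-- The group of the coordinates at `x` of the elements of the derived subgroup that fix the first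
level. -/
def derivedCoord (x : ZMod p) : Subgroup (treeAut (ZMod p)) :=
  (⁅directedGroup E, directedGroup E⁆.comap fiber).map (Pi.evalMonoidHom _ x)

theorem mem_derivedCoord {x : ZMod p} {g : treeAut (ZMod p)} : g ∈ derivedCoord E x ↔
    ∃ s, fiber s ∈ ⁅directedGroup E, directedGroup E⁆ ∧ s x = g := Iff.rfl

theorem mem_derivedCoord_of_mem {x : ZMod p} {g : treeAut (ZMod p)} (h : g ∈ derivedCoord E x)
    (y : ZMod p) : g ∈ derivedCoord E y := by
  obtain ⟨s, hs, rfl⟩ := mem_derivedCoord.1 h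
  refine ⟨fun t => s (t - (y - x)), ?_, by simp⟩
  have := conj_mem_derived _ hs _ (rot_mem (y - x))
  rwa [rot_conj_fiber] at this

theorem coord_mul_inv_mem_derivedCoord {v : {x : ZMod p // x ≠ 0} → ZMod p} (hv : v ∈ E)
    (x y : ZMod p) : directedCoord v x * (directedCoord v y)⁻¹ ∈ derivedCoord E x := by
  refine ⟨directedCoord v * (fun t => directedCoord v (t - (x - y)))⁻¹, ?_, by simp⟩
  rw [SetLike.mem_coe, Subgroup.mem_comap, map_mul, map_inv, ← rot_conj_fiber, ← directedAut_eq_fiber]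
  have := Subgroup.commutator_mem_commutator (directedAut_mem hv) (rot_mem (E := E) (x - y))
  convert this using 1
  rw [commutatorElement_def]
  group

/-- The coordinates of [b, aᶜ] are quotients of coordinates of b. Two entries differing by 1 give a,
and the recursive coordinate against a power of a gives b. Thus conjugation by G inside one
coordinate is induced by elements of G'. -/
theorem directedGroup_le_derivedCoord (hE : 2 ≤ Module.finrank (ZMod p) E) (x : ZMod p) :
    directedGroup E ≤ derivedCoord E x := by
  have ha : ∀ x c, rot c ∈ derivedCoord E x := by
    intro x c
    obtain ⟨v, hv, y, z, hy, hz, h⟩ := exists_nonconstant hE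
    have h1 := coord_mul_inv_mem_derivedCoord hv y z
    rw [directedCoord_of_ne v hy, directedCoord_of_ne v hz, ← rot_neg, ← rot_add,
      ← sub_eq_add_neg, h, rot_one] at h1
    exact pow_mem (mem_derivedCoord_of_mem h1 x) _
  refine directedGroup_le (ha x) fun v hv => mem_derivedCoord_of_mem (x := 0) ?_ x
  have := mul_mem (coord_mul_inv_mem_derivedCoord hv 0 1) (ha 0 (extendZero v 1))
  rwa [directedCoord_zero, directedCoord_of_ne v one_ne_zero, inv_mul_cancel_right] at this

variable (E) in
/-- The stabilizer of the first level. -/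
def firstStabilizer : Subgroup (treeAut (ZMod p)) := directedGroup E ⊓ fixLevel 1

theorem conj_mem_firstStabilizer :
    ∀ k ∈ firstStabilizer E, ∀ g ∈ directedGroup E, g * k * g⁻¹ ∈ firstStabilizer E := by
  rintro k ⟨hk, hk'⟩ g hg
  refine ⟨conj_mem_self k hk g hg, fun v hv => ?_⟩
  have := hk' (((g⁻¹ : treeAut (ZMod p)) : Equiv.Perm (List (ZMod p))) v)
    ((g⁻¹.2.1 v).trans hv)
  simp only [Subgroup.coe_mul, Equiv.Perm.mul_apply, this]
  simp

omit [Fact p.Prime] in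
theorem fiber_mem_fixLevel_one (s : ZMod p → treeAut (ZMod p)) : fiber s ∈ fixLevel 1 :=
  fiber_mem_fixLevel_succ.2 fun x v hv => by
    rw [List.eq_nil_of_length_eq_zero hv]
    exact List.eq_nil_of_length_eq_zero ((s x).2.1 [])

theorem directedAut_mem_firstStabilizer {v : {x : ZMod p // x ≠ 0} → ZMod p} (hv : v ∈ E) :
    directedAut v ∈ firstStabilizer E :=
  ⟨directedAut_mem hv, directedAut_eq_fiber v ▸ fiber_mem_fixLevel_one _⟩

theorem place_mem_commutator_firstStabilizer (hE : 2 ≤ Module.finrank (ZMod p) E) (x : ZMod p)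
    {d : treeAut (ZMod p)} (hd : d ∈ ⁅directedGroup E, directedGroup E⁆) :
    place x d ∈ ⁅firstStabilizer E, firstStabilizer E⁆ := by
  have hconj := conj_mem_commutator (conj_mem_firstStabilizer (E := E)) conj_mem_firstStabilizer
  have hK : ∀ k ∈ ⁅firstStabilizer E, firstStabilizer E⁆.comap (place x), ∀ g ∈ directedGroup E,
      g * k * g⁻¹ ∈ ⁅firstStabilizer E, firstStabilizer E⁆.comap (place x) := by
    intro k hk g hg
    obtain ⟨s, hs, rfl⟩ := mem_derivedCoord.1 (directedGroup_le_derivedCoord hE x hg)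
    have := hconj _ hk _ (commutator_self_le _ hs)
    rwa [fiber_mul_place_mul_inv] at this
  refine commutator_directedGroup_le hK ?_ hd
  -- By `hK` the condition on `v` is linear, so it need only be checked on the vectors for which
  -- `commutator_directedAut_conj` applies.
  let F : Submodule (ZMod p) ({x : ZMod p // x ≠ 0} → ZMod p) :=
    { carrier := {v | v ∈ E ∧ ⁅directedAut v, rot (1 : ZMod p)⁆ ∈
        ⁅firstStabilizer E, firstStabilizer E⁆.comap (place x)}
      zero_mem' := ⟨E.zero_mem, by
        rw [directedAut_zero, commutatorElement_one_left]; exact one_mem _⟩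
      add_mem' := by
        rintro v w ⟨hv, hv'⟩ ⟨hw, hw'⟩
        refine ⟨E.add_mem hv hw, ?_⟩
        rw [directedAut_add, commutator_mul_left]
        exact mul_mem (hK _ hw' _ (directedAut_mem hv)) hv'
      smul_mem' := by
        rintro c v ⟨hv, hv'⟩
        refine ⟨E.smul_mem c hv, ?_⟩
        rw [← ZMod.natCast_zmod_val c, Nat.cast_smul_eq_nsmul]
        induction c.val with
        | zero => rw [zero_nsmul, directedAut_zero, commutatorElement_one_left]; exact one_mem _
        | succ n ih =>
          rw [succ_nsmul', directedAut_add, commutator_mul_left]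
          exact mul_mem (hK _ ih _ (directedAut_mem hv)) hv' }
  suffices E ≤ F from fun v hv => (this hv).2
  refine le_of_vanishing_mem hE fun y hy w hw hwy v hv hvy => ⟨hv, ?_⟩
  have h1 : place y ⁅directedAut v, rot (1 : ZMod p)⁆ ∈
      ⁅firstStabilizer E, firstStabilizer E⁆ := by
    rw [← commutator_directedAut_conj hy hwy hvy]
    exact Subgroup.commutator_mem_commutator
      (conj_mem_firstStabilizer _ (directedAut_mem_firstStabilizer hv) _ (rot_mem y))
      (directedAut_mem_firstStabilizer hw)
  have := hconj _ h1 _ (rot_mem (x - y))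
  rwa [rot_conj_place, add_sub_cancel] at this

/-- Modulo G' an element of St_G(1) is a directed automorphism, and these commute with each other;
every remaining commutator involves an element of G'. -/
theorem commutator_firstStabilizer_le :
    ⁅firstStabilizer E, firstStabilizer E⁆ ≤
      ⁅⁅directedGroup E, directedGroup E⁆, directedGroup E⁆ := by
  have key : ∀ g ∈ firstStabilizer E, ∃ v ∈ E, ∃ d ∈ ⁅directedGroup E, directedGroup E⁆,
      g = directedAut v * d := by
    rintro g ⟨⟨c, v, h⟩, hg⟩
    obtain rfl : c = 0 := h.exponent_eq_zero hg
    refine ⟨v, h.vector_mem, _, h.inv_mul_mem_commutator, ?_⟩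
    rw [rot_zero, one_mul, mul_inv_cancel_left]
  have hconj := conj_mem_commutator (conj_mem_derived (E := E)) conj_mem_self
  rw [Subgroup.commutator_le]
  intro g hg h hh
  obtain ⟨v, hv, d, hd, rfl⟩ := key g hg
  rw [commutator_mul_left]
  refine mul_mem (hconj _ (Subgroup.commutator_mem_commutator hd hh.1) _ (directedAut_mem hv)) ?_
  obtain ⟨w, hw, d', hd', rfl⟩ := key h hh
  rw [commutator_mul_right, commutatorElement_eq_one_iff_mul_comm.2 (directedAut_comm v w),
    one_mul]
  refine hconj _ ?_ _ (directedAut_mem hw)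
  rw [← commutatorElement_inv]
  exact inv_mem (Subgroup.commutator_mem_commutator hd' (directedAut_mem hv))

/-! ### Level stabilizers inside normal subgroups -/

section branch

variable (hE : 2 ≤ Module.finrank (ZMod p) E)
include hE

theorem place_mem_derived (x : ZMod p) {d : treeAut (ZMod p)}
    (hd : d ∈ ⁅directedGroup E, directedGroup E⁆) :
    place x d ∈ ⁅directedGroup E, directedGroup E⁆ :=
  Subgroup.commutator_mono inf_le_left inf_le_left
    (place_mem_commutator_firstStabilizer hE x hd)

theorem placeAt_mem_derived (u : List (ZMod p)) {d : treeAut (ZMod p)}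
    (hd : d ∈ ⁅directedGroup E, directedGroup E⁆) :
    placeAt u d ∈ ⁅directedGroup E, directedGroup E⁆ := by
  induction u with
  | nil => exact hd
  | cons x u ih => exact place_mem_derived hE x ih

/-- Given g in G, choose an element of G' with coordinate g at `x`; its commutator with a copy of d
∈ G' at `x` is the copy of [d, g]. -/
theorem place_mem_derived_derived (x : ZMod p) {k : treeAut (ZMod p)}
    (hk : k ∈ ⁅⁅directedGroup E, directedGroup E⁆, directedGroup E⁆) :
    place x k ∈ ⁅⁅directedGroup E, directedGroup E⁆, ⁅directedGroup E, directedGroup E⁆⁆ := by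
  suffices ⁅⁅directedGroup E, directedGroup E⁆, directedGroup E⁆ ≤
    ⁅⁅directedGroup E, directedGroup E⁆, ⁅directedGroup E, directedGroup E⁆⁆.comap (place x) from
    this hk
  rw [Subgroup.commutator_le]
  intro d hd g hg
  obtain ⟨s, hs, rfl⟩ := mem_derivedCoord.1 (directedGroup_le_derivedCoord hE x hg)
  rw [Subgroup.mem_comap, ← commutator_place_fiber]
  exact Subgroup.commutator_mem_commutator (place_mem_derived hE x hd) hs

theorem mem_derived_derived_of_mem_fixLevel {g : treeAut (ZMod p)} (hg : g ∈ directedGroup E)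
    (hn : g ∈ fixLevel (Module.finrank (ZMod p) E + 3)) :
    g ∈ ⁅⁅directedGroup E, directedGroup E⁆, ⁅directedGroup E, directedGroup E⁆⁆ := by
  obtain ⟨s, rfl, hs⟩ := exists_fiber_of_mem_fixLevel hg hn
  refine fiber_mem_of_place_mem fun x => place_mem_derived_derived hE x ?_
  obtain ⟨t, ht, ht'⟩ := exists_fiber_of_mem_fixLevel (hs x).1 (hs x).2
  rw [ht]
  exact fiber_mem_of_place_mem fun y => commutator_firstStabilizer_le
    (place_mem_commutator_firstStabilizer hE y
      (mem_commutator_of_mem_fixLevel (ht' y).1 (ht' y).2))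

theorem mem_of_placeAt_mem {n : ℕ} {H : Subgroup (treeAut (ZMod p))}
    (hH : ∀ u : List (ZMod p), u.length = n →
      ∀ k ∈ ⁅⁅directedGroup E, directedGroup E⁆, ⁅directedGroup E, directedGroup E⁆⁆,
        placeAt u k ∈ H) {g : treeAut (ZMod p)} (hg : g ∈ directedGroup E)
    (hn : g ∈ fixLevel (Module.finrank (ZMod p) E + 3 + n)) : g ∈ H := by
  induction n generalizing H g with
  | zero => exact hH [] rfl g (mem_derived_derived_of_mem_fixLevel hE hg hn)
  | succ n ih =>
    obtain ⟨s, rfl, hs⟩ := exists_fiber_of_mem_fixLevel hg hn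
    exact fiber_mem_of_place_mem fun x => ih (H := H.comap (place x))
      (fun u hu k hk => hH (x :: u) (by rw [List.length_cons, hu]) k hk) (hs x).1 (hs x).2

/-- A rotation corrects the first letter; the rest is corrected by an element of G' with prescribed
coordinate there. -/
theorem exists_mem_apply_eq (u v : List (ZMod p)) (h : u.length = v.length) :
    ∃ g ∈ directedGroup E, (g : Equiv.Perm (List (ZMod p))) u = v := by
  induction u generalizing v with
  | nil => exact ⟨1, one_mem _, by simpa using h.symm⟩
  | cons x u ih =>
    cases v with
    | nil => simp at h
    | cons y v =>
      obtain ⟨g, hg, rfl⟩ := ih v (by simpa using h)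
      obtain ⟨s, hs, rfl⟩ := mem_derivedCoord.1 (directedGroup_le_derivedCoord hE y hg)
      refine ⟨fiber s * rot (y - x), mul_mem (commutator_self_le _ hs) (rot_mem _), ?_⟩
      rw [Subgroup.coe_mul, Equiv.Perm.mul_apply, rot_cons, add_sub_cancel, fiber_cons]

/-- A group of order n transitive on the pⁿ vertices of level n would give pⁿ ≤ n. -/
theorem infinite_directedGroup : Infinite (directedGroup E) := by
  by_contra hfin
  rw [not_infinite_iff_finite] at hfin
  set n := Nat.card (directedGroup E)
  have hsurj : Function.Surjective (fun g : directedGroup E =>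
      (⟨(g.1 : Equiv.Perm (List (ZMod p))) (List.replicate n 0), by
        rw [g.1.2.1, List.length_replicate]⟩ : List.Vector (ZMod p) n)) := by
    rintro ⟨v, hv⟩
    obtain ⟨g, hg, h⟩ := exists_mem_apply_eq hE (List.replicate n 0) v (by simp [hv])
    exact ⟨⟨g, hg⟩, Subtype.ext h⟩
  have : Nat.card (List.Vector (ZMod p) n) ≤ n := Nat.card_le_card_of_surjective _ hsurj
  rw [Nat.card_eq_fintype_card (α := List.Vector (ZMod p) n), card_vector, ZMod.card] at this
  exact (Nat.lt_pow_self (Fact.out : p.Prime).one_lt).not_ge this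

theorem exists_fixLevel_le_of_conj_mem {N : Subgroup (treeAut (ZMod p))}
    (hN : ∀ g ∈ N, ∀ h ∈ directedGroup E, h * g * h⁻¹ ∈ N) (hN1 : N ≠ ⊥) :
    ∃ n, ∀ g ∈ directedGroup E, g ∈ fixLevel n → g ∈ N := by
  obtain ⟨g, hg, hg1⟩ := N.bot_or_exists_ne_one.resolve_left hN1
  obtain ⟨u, hu⟩ : ∃ u, (g : Equiv.Perm (List (ZMod p))) u ≠ u := by
    by_contra! h
    exact hg1 (Subtype.ext (Equiv.ext h))
  refine ⟨_, fun k hk hk' => mem_of_placeAt_mem hE (n := u.length) (fun v hv => ?_) hk hk'⟩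
  obtain ⟨h, hh, rfl⟩ := exists_mem_apply_eq hE u v hv.symm
  -- The conjugate of `g` by `h` moves `v`, the image of `u`. Taking K = G', whose copies at `v` lie
  -- in G, puts the copy of G'' at `v` in `N`.
  refine placeAt_commutator_mem hN (hN _ hg h hh) ?_
    fun k hk => commutator_self_le _ (placeAt_mem_derived hE _ hk)
  simpa using hu

end branch

end MultiGGS

open MultiGGS treeAut in
theorem mainTheorem2 (p : ℕ) [Fact p.Prime] (hp : Odd p) (r : ℕ) (hr : 2 ≤ r)
    (e : Fin r → {x : ZMod p // x ≠ 0} → ZMod p) (he : LinearIndependent (ZMod p) e) :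
    HasCongruenceSubgroupProperty (multiGGSGroup e) ∧
      levelStabilizer (multiGGSGroup e) (r + 3) ≤ derivedSeries (multiGGSGroup e) 2 := by
  have hrank : Module.finrank (ZMod p) (Submodule.span (ZMod p) (Set.range e)) = r := by
    rw [finrank_span_eq_card he, Fintype.card_fin]
  rw [multiGGSGroup_eq]
  generalize Submodule.span (ZMod p) (Set.range e) = E at hrank
  subst hrank
  refine ⟨fun H hH => ?_, fun g hg => ?_⟩
  · have hinf := infinite_directedGroup hr
    -- The normal core has finite index in an infinite group, so it cannot be trivial.
    have hN : H.normalCore.map (directedGroup E).subtype ≠ ⊥ := by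
      intro h
      rw [Subgroup.map_eq_bot_iff_of_injective _ Subtype.val_injective] at h
      have h2 : (⊥ : Subgroup (directedGroup E)).FiniteIndex :=
        h ▸ (inferInstance : H.normalCore.FiniteIndex)
      have := Subgroup.finite_quotient_of_finiteIndex (H := (⊥ : Subgroup (directedGroup E)))
      exact not_finite_iff_infinite.2 hinf
        (Finite.of_equiv _ QuotientGroup.quotientBot.toEquiv)
    have hconj : ∀ g ∈ H.normalCore.map (directedGroup E).subtype, ∀ h ∈ directedGroup E,
        h * g * h⁻¹ ∈ H.normalCore.map (directedGroup E).subtype := by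
      rintro _ ⟨g, hg, rfl⟩ h hh
      lift h to directedGroup E using hh
      refine ⟨h * g * h⁻¹, H.normalCore_normal.conj_mem g hg h, ?_⟩
      rw [map_mul, map_mul, map_inv, Subgroup.subtype_apply, Subgroup.subtype_apply]
    obtain ⟨n, hn⟩ := exists_fixLevel_le_of_conj_mem hr hconj hN
    refine ⟨n, fun g hg => H.normalCore_le ?_⟩
    obtain ⟨g', hg', h⟩ := hn g.1 g.2 hg
    rwa [← Subtype.ext h]
  · have hmap : (derivedSeries (directedGroup E) 2).map (directedGroup E).subtype =
        ⁅⁅directedGroup E, directedGroup E⁆, ⁅directedGroup E, directedGroup E⁆⁆ := by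
      simp only [derivedSeries_succ, derivedSeries_zero, Subgroup.map_commutator,
        ← MonoidHom.range_eq_map, Subgroup.range_subtype]
    have := mem_derived_derived_of_mem_fixLevel hr g.2 hg
    rw [← hmap] at this
    obtain ⟨g', hg', h⟩ := this
    rwa [← Subtype.ext h]
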